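/- All graphs are finite, simple and undirected. For a graph $X$ with adjacency matrix $A(X)$ and vertices $x,y$, let $e_x$ denote the standard basis vector indexed by $x$. The graph $X$ has perfect state transfer between two distinct vertices $x,y$ if there are $t>0$ and $\lambda\in\mathbb{C}$ with $|\lambda|=1$ such that $\exp(-itA(X))e_x=\lambda e_y$; it is periodic at $x$ if there are $t>0$ and $\lambda\in\mathbb{C}$ with $|\lambda|=1$ such that $\exp(-itA(X))e_x=\lambda e_x$. The neighborhood corona $G_1\bigstar G_2$ has vertex set $V(G_1)\times(\{0\}\sqcup V(G_2))$, where $(x,y)$ and $(x',y')$ are adjacent if and only if one of the following holds: $y=y'=0$ and $xx'\in E(G_1)$; or $x=x'$, $y,y'\in V(G_2)$ and $yy'\in E(G_2)$; or $xx'\in E(G_1)$ and exactly one of $y,y'$ is $0$. Let $P_3$ be the path on three vertices. **Theorem 4.6.** Let $k\ge 0$ be an integer and let $G$ be a connected $k$-regular graph. Then $P_3\bigstar G$ has no perfect state transfer between any two distinct vertices. Moreover, $P_3\bigstar G$ is not periodic at any of its vertices. -/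

import Mathlib

namespace QuantumWalk

/-- The neighborhood corona of `G` and `H`: one copy of `G`, with vertices `(x, none)`, and for each
vertex `x` of `G` a copy of `H`, with vertices `(x, some y)`; moreover every neighbor in `G` of `x` is
joined to all vertices of the copy of `H` that belongs to `x`. -/
def neighborhoodCorona {V W : Type*} (G : SimpleGraph V) (H : SimpleGraph W) :
    SimpleGraph (V × Option W) where
  Adj p q :=
    match p, q with
    | (x, none), (x', none) => G.Adj x x'
    | (x, none), (x', some _) => G.Adj x x'
    | (x, some _), (x', none) => G.Adj x x'
    | (x, some y), (x', some y') => x = x' ∧ H.Adj y y'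
  symm := ⟨by
    rintro ⟨x, _ | y⟩ ⟨x', _ | y'⟩ h
    · exact G.adj_symm h
    · exact G.adj_symm h
    · exact G.adj_symm h
    · exact ⟨h.1.symm, H.adj_symm h.2⟩⟩
  loopless := ⟨by
    rintro ⟨x, _ | y⟩ h
    · exact G.irrefl h
    · exact H.irrefl h.2⟩

section

variable {V : Type*} [Fintype V] [DecidableEq V] (G : SimpleGraph V)

open Classical in
/-- The transition matrix `exp (-i t A(G))` of the continuous-time quantum walk on `G`. -/
noncomputable def transitionMatrix (t : ℝ) : Matrix V V ℂ :=
  NormedSpace.exp ((-(Complex.I * (t : ℂ))) • G.adjMatrix ℂ)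

/-- `exp (-i t A(G)) e_x = c e_y` for some complex number `c` of modulus one. -/
def TransfersAt (x y : V) (t : ℝ) : Prop :=
  ∃ c : ℂ, ‖c‖ = 1 ∧
    (transitionMatrix G t).mulVec (Pi.single x 1) = c • (Pi.single y 1 : V → ℂ)

/-- `G` admits perfect state transfer between some two distinct vertices at some positive time. -/
def AdmitsPST : Prop :=
  ∃ x y : V, x ≠ y ∧ ∃ t : ℝ, 0 < t ∧ TransfersAt G x y t

/-- `G` is periodic at the vertex `x`: the walk started at `x` returns to `x`, up to a phase, at some
positive time. -/
def IsPeriodicAt (x : V) : Prop :=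
  ∃ t : ℝ, 0 < t ∧ TransfersAt G x x t

end

end QuantumWalk

namespace QuantumWalk

open Matrix

/-! A transfer at time `t`, to the same vertex or another, forces all eigenvalues having a real
eigenvector nonzero at the start to agree modulo `π / t` (`TransfersAt.exp_mul_eq`). Lifting the
eigenvectors `(1, θ, 1)` of `P₃`, `θ = ±√2`, gives four eigenvalues with nowhere vanishing
eigenvectors, so every vertex sees them all. Their differences would be commensurable, which
irrationality of `√2` (`k ≠ 0`) or `√5` (`k = 0`) forbids. -/

open scoped Matrix.Norms.Operator in
theorem exp_mulVec_of_mulVec_eq_smul {V : Type*} [Fintype V] [DecidableEq V]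
    {A : Matrix V V ℂ} {v : V → ℂ} {μ : ℂ} (h : A *ᵥ v = μ • v) :
    NormedSpace.exp A *ᵥ v = Complex.exp μ • v := by
  have hpow : ∀ n : ℕ, (A ^ n) *ᵥ v = μ ^ n • v := by
    intro n
    induction n with
    | zero => simp
    | succ n ih => rw [pow_succ, ← mulVec_mulVec, h, mulVec_smul, ih, smul_smul, pow_succ, mul_comm]
  have hA := NormedSpace.exp_series_hasSum_exp' (𝕂 := ℂ) A
  have hμ := NormedSpace.exp_series_hasSum_exp' (𝕂 := ℂ) μ
  rw [← Complex.exp_eq_exp_ℂ] at hμ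
  have h₁ := hA.map (LinearMap.toAddMonoidHom
    ((Matrix.mulVecBilin ℂ ℂ).flip v : Matrix V V ℂ →ₗ[ℂ] (V → ℂ)))
    (LinearMap.continuous_of_finiteDimensional _)
  have h₂ := hμ.smul_const v
  refine h₁.unique ?_
  convert h₂ using 1
  funext n
  simp [hpow, smul_smul]

-- Symmetry of the transition matrix gives `exp(-itμ) v x = c v y`, so `v y = ± v x`; squaring
-- removes the sign, the only dependence on `v`.
open Classical in
theorem TransfersAt.exp_mul_eq {V : Type*} [Fintype V] [DecidableEq V] {X : SimpleGraph V}
    {x y : V} {t : ℝ} (h : TransfersAt X x y t) :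
    ∃ c : ℂ, ∀ (v : V → ℝ) (μ : ℝ), v x ≠ 0 → X.adjMatrix ℝ *ᵥ v = μ • v →
      Complex.exp (-(2 * t * μ * Complex.I)) = c := by
  obtain ⟨c, hc, hU⟩ := h
  refine ⟨c ^ 2, fun v μ hx hv => ?_⟩
  set w : V → ℂ := fun i => (v i : ℂ) with hw
  have hAw : X.adjMatrix ℂ *ᵥ w = (μ : ℂ) • w := by
    funext i
    have := congrFun hv i
    simp only [SimpleGraph.adjMatrix_mulVec_apply, Pi.smul_apply, smul_eq_mul, hw] at this ⊢
    exact_mod_cast this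
  have hexp := exp_mulVec_of_mulVec_eq_smul (A := (-(Complex.I * (t : ℂ))) • X.adjMatrix ℂ)
    (v := w) (μ := -(Complex.I * t) * μ) (by rw [smul_mulVec, hAw, smul_smul])
  have hsymm : (transitionMatrix X t)ᵀ = transitionMatrix X t := by
    rw [transitionMatrix, ← Matrix.exp_transpose, transpose_smul, SimpleGraph.transpose_adjMatrix]
  have hxy : Complex.exp (-(Complex.I * t) * μ) * v x = c * v y := by
    have h₁ : w ⬝ᵥ (transitionMatrix X t *ᵥ Pi.single x 1) = c * v y := by
      rw [hU]; simp [hw]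
    rw [dotProduct_mulVec, ← mulVec_transpose, hsymm, transitionMatrix, hexp] at h₁
    simpa [hw] using h₁
  have hnorm : v x ^ 2 = v y ^ 2 := by
    have := congrArg norm hxy
    rw [norm_mul, norm_mul, hc, Complex.norm_exp] at this
    simp at this
    exact sq_eq_sq_iff_abs_eq_abs _ _ |>.2 this
  have hx' : (v x : ℂ) ^ 2 ≠ 0 := pow_ne_zero 2 (by exact_mod_cast hx)
  apply mul_right_cancel₀ hx'
  have h₂ : ((v x : ℂ)) ^ 2 = (v y : ℂ) ^ 2 := by exact_mod_cast hnorm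
  calc _ = (Complex.exp (-(Complex.I * t) * μ) * v x) ^ 2 := by
        rw [mul_pow, ← Complex.exp_nat_mul]; congr 2; push_cast; ring
    _ = _ := by rw [hxy, mul_pow, h₂]

theorem exists_int_mul_sub_eq {t μ ν : ℝ}
    (h : Complex.exp (-(2 * t * μ * Complex.I)) = Complex.exp (-(2 * t * ν * Complex.I))) :
    ∃ m : ℤ, t * (μ - ν) = m * Real.pi := by
  obtain ⟨m, hm⟩ := Complex.exp_eq_exp_iff_exists_int.1 h
  refine ⟨-m, ?_⟩
  have := congrArg Complex.im hm
  simp at this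
  push_cast
  linarith

/-- A nowhere vanishing vector, an eigenvector of `P₃ ★ G` for suitable parameters. -/
def coronaVector (V : Type*) (θ a : ℝ) : Fin 3 × Option V → ℝ
  | (i, none) => ![1, θ, 1] i * a
  | (i, some _) => ![1, θ, 1] i * θ

theorem coronaVector_ne_zero {V : Type*} {θ a : ℝ} (hθ : θ ≠ 0) (ha : a ≠ 0)
    (p : Fin 3 × Option V) : coronaVector V θ a p ≠ 0 := by
  obtain ⟨i, _ | y⟩ := p <;> fin_cases i <;> simp [coronaVector, hθ, ha]

-- Copies of `G` force the weight ratio `a / θ` with `a = μ - k`; the base vertices then give the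
-- quadratic for `μ`.
open Classical in
theorem adjMatrix_neighborhoodCorona_mulVec_coronaVector {V : Type*} [Fintype V] [DecidableEq V]
    (G : SimpleGraph V) [DecidableRel G.Adj] {k : ℕ} (hreg : G.IsRegularOfDegree k) {θ μ : ℝ}
    (hθ : θ ^ 2 = 2) (hμ : (μ - θ) * (μ - k) = 2 * Fintype.card V) :
    (neighborhoodCorona (SimpleGraph.pathGraph 3) G).adjMatrix ℝ *ᵥ coronaVector V θ (μ - k) =
      μ • coronaVector V θ (μ - k) := by
  have hdeg : ∀ y : V, ∀ b : ℝ, (∑ z, if G.Adj y z then b else 0) = k * b := by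
    intro y b
    rw [← Finset.sum_filter, Finset.sum_const, nsmul_eq_mul, ← hreg y,
      ← SimpleGraph.card_neighborFinset_eq_degree, SimpleGraph.neighborFinset_eq_filter]
  funext ⟨i, o⟩
  simp only [mulVec, dotProduct, SimpleGraph.adjMatrix_apply, ite_mul, one_mul, zero_mul,
    Fintype.sum_prod_type, Fintype.sum_option, Fin.sum_univ_three, Pi.smul_apply, smul_eq_mul]
  obtain _ | y := o <;> fin_cases i <;>
    simp [neighborhoodCorona, coronaVector, SimpleGraph.pathGraph_adj, hdeg]
  · linear_combination hθ * Fintype.card V - hμ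
  · linear_combination -θ * hμ - (μ - k) * hθ
  · linear_combination hθ * Fintype.card V - hμ
  · ring
  · linear_combination -(μ - k) * hθ
  · ring

/-- The squares are conjugate in `ℚ(√2)`, so a rational ratio `d₁ / d₂` gives an equation linear in
`√2`, with leading coefficient nonzero because `k` and `m₂` are. -/
theorem not_int_ratio_of_sq_eq {k N : ℕ} (hk : k ≠ 0) {t d₁ d₂ : ℝ} (ht : t ≠ 0) (hd₂ : d₂ ≠ 0)
    (h₁ : d₁ ^ 2 = (√2 - k) ^ 2 + 8 * N) (h₂ : d₂ ^ 2 = (-√2 - k) ^ 2 + 8 * N) {m₁ m₂ : ℤ}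
    (hm₁ : t * d₁ = m₁ * Real.pi) (hm₂ : t * d₂ = m₂ * Real.pi) : False := by
  have hs : √2 ^ 2 = (2 : ℝ) := Real.sq_sqrt (by norm_num)
  have hm₂0 : (m₂ : ℝ) ≠ 0 := by
    intro h
    rw [h, zero_mul] at hm₂
    exact mul_ne_zero ht hd₂ hm₂
  have hcross : d₁ * m₂ = d₂ * m₁ := by
    apply mul_left_cancel₀ (mul_ne_zero ht Real.pi_ne_zero)
    linear_combination m₂ * Real.pi * hm₁ - m₁ * Real.pi * hm₂
  have hsq : (d₁ ^ 2) * m₂ ^ 2 = d₂ ^ 2 * m₁ ^ 2 := by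
    linear_combination (d₁ * m₂ + d₂ * m₁) * hcross
  rw [h₁, h₂] at hsq
  have hden : (0 : ℝ) < 2 * k * (m₁ ^ 2 + m₂ ^ 2) := by positivity
  have hval : √2 = ((2 + k ^ 2 + 8 * N) * (m₂ ^ 2 - m₁ ^ 2) : ℤ) /
      (2 * k * (m₁ ^ 2 + m₂ ^ 2) : ℤ) := by
    push_cast
    rw [eq_div_iff hden.ne']
    linear_combination -hsq + (m₂ ^ 2 - m₁ ^ 2) * hs
  exact irrational_sqrt_two.ne_rational _ _ hval

theorem not_int_ratio_sqrt_five {t d : ℝ} (ht : t ≠ 0) (hd : d ≠ 0) {m₁ m₂ : ℤ}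
    (hm₁ : t * (√5 * d) = m₁ * Real.pi) (hm₂ : t * d = m₂ * Real.pi) : False := by
  have hm₂0 : (m₂ : ℝ) ≠ 0 := by
    intro h
    rw [h, zero_mul] at hm₂
    exact mul_ne_zero ht hd hm₂
  have hval : √5 = m₁ / m₂ := by
    rw [eq_div_iff hm₂0]
    apply mul_left_cancel₀ Real.pi_ne_zero
    linear_combination hm₁ - √5 * hm₂
  exact (Nat.prime_five.irrational_sqrt.ne_rational _ _) (by exact_mod_cast hval)

theorem card_eq_one_of_connected_of_isRegularOfDegree_zero {V : Type*} [Fintype V]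
    {G : SimpleGraph V} [DecidableRel G.Adj] (hconn : G.Connected)
    (hreg : G.IsRegularOfDegree 0) : Fintype.card V = 1 := by
  have := hconn.nonempty
  refine le_antisymm ?_ Fintype.card_pos
  by_contra! h
  have : Nontrivial V := Fintype.one_lt_card_iff_nontrivial.1 h
  obtain ⟨v⟩ := hconn.nonempty
  have := hconn.preconnected.degree_pos_of_nontrivial v
  exact this.ne' (hreg v)

theorem not_transfersAt_neighborhoodCorona_pathGraph_three {V : Type*} [Fintype V] [DecidableEq V]
    {G : SimpleGraph V} [DecidableRel G.Adj] {k : ℕ} (hconn : G.Connected)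
    (hreg : G.IsRegularOfDegree k) {p q : Fin 3 × Option V} {t : ℝ} (ht : t ≠ 0) :
    ¬ TransfersAt (neighborhoodCorona (SimpleGraph.pathGraph 3) G) p q t := by
  intro h
  have := hconn.nonempty
  obtain ⟨c, hc⟩ := h.exp_mul_eq
  have hN : (0 : ℝ) < Fintype.card V := by exact_mod_cast Fintype.card_pos
  have hs : √2 ^ 2 = (2 : ℝ) := Real.sq_sqrt (by norm_num)
  -- The roots of the quadratic for `μ` are `(θ + k ± d) / 2`; for fixed `θ` they differ by `d`.
  have heig : ∀ θ d : ℝ, θ ^ 2 = 2 → d ^ 2 = (θ - k) ^ 2 + 8 * Fintype.card V →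
      Complex.exp (-(2 * t * ((θ + k + d) / 2 : ℝ) * Complex.I)) = c := by
    intro θ d hθ hd
    have hμ : ((θ + k + d) / 2 - θ) * ((θ + k + d) / 2 - k) = 2 * Fintype.card V := by
      linear_combination hd / 4
    refine hc _ _ (coronaVector_ne_zero ?_ ?_ p)
      (adjMatrix_neighborhoodCorona_mulVec_coronaVector G hreg hθ hμ)
    · rintro rfl
      norm_num at hθ
    · intro h0
      rw [h0, mul_zero] at hμ
      linarith
  have hgap : ∀ θ d : ℝ, θ ^ 2 = 2 → d ^ 2 = (θ - k) ^ 2 + 8 * Fintype.card V →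
      ∃ m : ℤ, t * d = m * Real.pi := by
    intro θ d hθ hd
    obtain ⟨m, hm⟩ := exists_int_mul_sub_eq
      ((heig θ d hθ hd).trans (heig θ (-d) hθ (by rw [neg_sq, hd])).symm)
    exact ⟨m, by rw [← hm]; ring⟩
  have hneg : (-√2) ^ 2 = (2 : ℝ) := by rw [neg_sq, hs]
  obtain rfl | hk := eq_or_ne k 0
  -- Here both `θ` share the gap `√10 = √5 * √2`, so it is compared instead with the difference `√2`
  -- between eigenvalues of opposite `θ`.
  · have hcard := card_eq_one_of_connected_of_isRegularOfDegree_zero hconn hreg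
    have h5 : √5 ^ 2 = (5 : ℝ) := Real.sq_sqrt (by norm_num)
    have hd : ∀ θ : ℝ, θ ^ 2 = 2 →
        (√5 * √2) ^ 2 = (θ - (0 : ℕ)) ^ 2 + 8 * (Fintype.card V : ℝ) := by
      intro θ hθ
      rw [hcard, mul_pow, h5, hs, Nat.cast_zero, sub_zero, hθ]
      norm_num
    obtain ⟨m₁, hm₁⟩ := hgap _ _ hs (hd _ hs)
    obtain ⟨m₂, hm₂⟩ := exists_int_mul_sub_eq
      ((heig _ _ hs (hd _ hs)).trans (heig _ _ hneg (hd _ hneg)).symm)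
    exact not_int_ratio_sqrt_five ht (by positivity) hm₁
      (hm₂ ▸ by ring : t * √2 = m₂ * Real.pi)
  · have hsq : ∀ θ : ℝ, √((θ - k) ^ 2 + 8 * Fintype.card V) ^ 2 =
        (θ - k) ^ 2 + 8 * Fintype.card V := fun θ => Real.sq_sqrt (by positivity)
    obtain ⟨m₁, hm₁⟩ := hgap _ _ hs (hsq _)
    obtain ⟨m₂, hm₂⟩ := hgap _ _ hneg (hsq _)
    exact not_int_ratio_of_sq_eq hk ht (by positivity) (hsq _) (hsq _) hm₁ hm₂

end QuantumWalk

theorem theorem4p6 {V : Type*} [Fintype V] [DecidableEq V] (G : SimpleGraph V)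
    [DecidableRel G.Adj] (k : ℕ) (hconn : G.Connected) (hreg : G.IsRegularOfDegree k) :
    (¬ QuantumWalk.AdmitsPST
        (QuantumWalk.neighborhoodCorona (SimpleGraph.pathGraph 3) G)) ∧
      ∀ p : Fin 3 × Option V,
        ¬ QuantumWalk.IsPeriodicAt
          (QuantumWalk.neighborhoodCorona (SimpleGraph.pathGraph 3) G) p := by
  constructor
  · rintro ⟨x, y, -, t, ht, h⟩
    exact QuantumWalk.not_transfersAt_neighborhoodCorona_pathGraph_three hconn hreg ht.ne' h
  · rintro p ⟨t, ht, h⟩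
    exact QuantumWalk.not_transfersAt_neighborhoodCorona_pathGraph_three hconn hreg ht.ne' h
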